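/- Let $H$ be a Hopf algebra over a field $k$ with comultiplication $\Delta(h)=h_1\otimes h_2$ (summation understood), counit $\varepsilon$ and antipode $S$, and let $*$ denote the convolution product on $H^*=\mathrm{Hom}_k(H,k)$, $(p*q)(h)=p(h_1)q(h_2)$, with unit $\varepsilon$. Assume that $H$ is co-Frobenius, that is, the largest rational submodule $H^{*\mathrm{rat}}$ of the left $H^*$-module $H^*$ is nonzero; here $f\in H^*$ is rational if there are finitely many $h_i\in H$, $f_i\in H^*$ with $p*f=\sum_i p(h_i)f_i$ for all $p\in H^*$. A left integral is an element $\lambda\in H^*$ with $p*\lambda=p(1)\lambda$ for all $p\in H^*$. Let $a\in H$ be the modular element of $H$, i.e. the grouplike element such that $\lambda(h_1)h_2=\lambda(h)a^{-1}$ for all left integrals $\lambda$ and all $h\in H$. Let $\alpha=\varepsilon\circ\chi\in H^*$ be the modular element in $H^*$, where $\chi$ is the generalized Frobenius automorphism, i.e. the algebra automorphism of $H$ such that $\lambda(mh)=\lambda(\chi(h)m)$ for all left integrals $\lambda$ and all $h,m\in H$. Let $\sigma:H\otimes H\to k$ be a coquasitriangular structure on $H$, i.e. a linear map such that for all $h,l,m\in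 H$ $$\sigma(hl,m)=\sigma(h,m_1)\sigma(l,m_2),\qquad \sigma(h,lm)=\sigma(h_1,m)\sigma(h_2,l),$$ $$\sigma(h,1)=\sigma(1,h)=\varepsilon(h),\qquad l_1h_1\,\sigma(h_2,l_2)=\sigma(h_1,l_1)\,h_2l_2 .$$ Define $u,v\in H^*$ by $u(h)=\sigma(h_2,S(h_1))$ and $v=u\circ S$, and put $\alpha_a=\sigma(-,a^{-1})$ and $\beta_a=\sigma(a,-)$. Then $u$ is invertible with respect to convolution, and $$u^{-1}*v=v*u^{-1}=\alpha*\beta_a=\alpha*\alpha_a .$$ -/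

import Mathlib

open Coalgebra HopfAlgebra TensorProduct WithConv

noncomputable section

namespace CoFrobeniusHopf

variable {k H : Type*} [Field k] [Ring H] [HopfAlgebra k H]

/-- A linear functional `f` on `H` is rational if it lies in the largest rational submodule of
`H*`, regarded as a left module over itself by convolution: there are finitely many
`hᵢ ∈ H` and `fᵢ ∈ H*` such that `p * f = ∑ p(hᵢ) fᵢ` for every `p ∈ H*`. -/
def IsRational (f : H →ₗ[k] k) : Prop :=
  ∃ (n : ℕ) (h : Fin n → H) (g : Fin n → (H →ₗ[k] k)),
    ∀ p : H →ₗ[k] k, toConv p * toConv f = toConv (∑ i, p (h i) • g i)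

variable (k H) in
/-- `H` is co-Frobenius if the largest rational submodule of `H*` is nonzero. -/
def IsCoFrobenius : Prop :=
  ∃ f : H →ₗ[k] k, IsRational f ∧ f ≠ 0

/-- `lam` is a left integral for `H`, an element of `H*`: `p * lam = p(1) lam` for all `p ∈ H*`. -/
def IsLeftIntegral (lam : H →ₗ[k] k) : Prop :=
  ∀ p : H →ₗ[k] k, toConv p * toConv lam = toConv (p 1 • lam)

/-- The grouplike element `a` is the modular element of `H`:
`lam(h₁) h₂ = lam(h) a⁻¹` for every left integral `lam` and every `h`. -/
def IsModularElement (a : GroupLike k H) : Prop :=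
  ∀ lam : H →ₗ[k] k, IsLeftIntegral lam →
    ∀ h : H, TensorProduct.lid k H (lam.rTensor H (comul h)) = lam h • (a⁻¹).val

/-- `chi` is the generalized Frobenius (Nakayama) automorphism of `H`: for every left integral
`lam` one has `h ⇀ lam = lam ↼ chi(h)`, that is, `lam(m h) = lam(chi(h) m)`. -/
def IsFrobeniusAut (chi : H ≃ₐ[k] H) : Prop :=
  ∀ lam : H →ₗ[k] k, IsLeftIntegral lam → ∀ h m : H, lam (m * h) = lam (chi h * m)

/-- `alpha` is the modular element of `H` in `H*`: the counit composed with the generalized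
Frobenius automorphism. -/
def IsModularFunctional (alpha : H →ₗ[k] k) : Prop :=
  ∃ chi : H ≃ₐ[k] H, IsFrobeniusAut chi ∧ ∀ h : H, alpha h = counit (chi h)

/-- A bilinear form `σ`, viewed as a map `H ⊗ H → k`, is a coquasitriangular structure on `H`. -/
structure IsCoquasitriangular (σ : H →ₗ[k] H →ₗ[k] k) : Prop where
  /-- `σ(hl, m) = σ(h, m₁) σ(l, m₂)` -/
  mul_left : ∀ h l m : H, σ (h * l) m = (toConv (σ h) * toConv (σ l)) m
  /-- `σ(h, lm) = σ(h₁, m) σ(h₂, l)` -/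
  mul_right : ∀ h l m : H, σ h (l * m) = (toConv (σ.flip m) * toConv (σ.flip l)) h
  /-- `σ(h, 1) = ε(h)` -/
  right_one : ∀ h : H, σ h 1 = counit h
  /-- `σ(1, h) = ε(h)` -/
  left_one : ∀ h : H, σ 1 h = counit h
  /-- `l₁ h₁ σ(h₂, l₂) = σ(h₁, l₁) h₂ l₂`, as an identity of convolution products of linear maps
  from the tensor product coalgebra `H ⊗ H` to `H`, evaluated at `h ⊗ l`. -/
  comm :
    toConv (LinearMap.mul' k H ∘ₗ (TensorProduct.comm k H H).toLinearMap) *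
        toConv (Algebra.linearMap k H ∘ₗ TensorProduct.lift σ) =
      toConv (Algebra.linearMap k H ∘ₗ TensorProduct.lift σ) * toConv (LinearMap.mul' k H)

/-- The functional `u(h) = σ(h₂, S(h₁))`. -/
def drinfeldU (σ : H →ₗ[k] H →ₗ[k] k) : H →ₗ[k] k :=
  TensorProduct.lift σ.flip ∘ₗ (antipode k).rTensor H ∘ₗ comul

/-- The functional `v = u ∘ S`. -/
def drinfeldV (σ : H →ₗ[k] H →ₗ[k] k) : H →ₗ[k] k :=
  drinfeldU σ ∘ₗ antipode k

/-- The functional `α_g = σ(-, g⁻¹)`. -/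
def alphaOf (σ : H →ₗ[k] H →ₗ[k] k) (g : GroupLike k H) : H →ₗ[k] k :=
  σ.flip (g⁻¹).val

/-- The functional `β_g = σ(g, -)`. -/
def betaOf (σ : H →ₗ[k] H →ₗ[k] k) (g : GroupLike k H) : H →ₗ[k] k :=
  σ g.val

end CoFrobeniusHopf

end

/-!
Let `λ` be a nonzero left integral and apply it to the commutation relation of `σ`:

  `∑ λ(l₁ h₁) σ(h₂, l₂) = ∑ σ(h₁, l₁) λ(h₂ l₂)`.

The invariance properties `∑ h₁ λ(h₂) = λ(h) 1` and `∑ λ(h₁) h₂ = λ(h) a⁻¹` allow a tensor leg to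
be moved from one argument of the bilinear form `λ(hl)` to the other, at the cost of an antipode
and, in the second case, of a factor `a⁻¹`. Moving all legs to `h`, and using `v(h) = σ(h₁, S(h₂))`,
turns the relation into `∑ v(h₁) λ(h₂ l) = ∑ λ(l h₁) (u * α_a)(h₂)`. By the definition of `χ` and
the nondegeneracy of `λ(hl)`, this says `∑ v(h₁) h₂ = ∑ χ(h₁) (u * α_a)(h₂)`
(`sweedler_drinfeldV_smul`), and the counit gives `v = α * u * α_a`. Moving all legs to `l`, with
`S(l)` in place of `l` so that no inverse of `S` is needed, gives `(α ∘ S) * v = β_a * u`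
(`sweedler_drinfeldV_smul_antipode`), that is, `v = α * β_a * u`.

Characters of `H`, such as `α` and `α_a`, commute with `u`: apply the character to
`∑ u(h₂) h₃ S(h₁) = u(h) 1`, the commutation relation of `σ` at `h₂ ⊗ S(h₁)`. The same relation
shows that `u` implements `S²`, and hence that `u` is invertible. The theorem follows.

A nonzero left integral exists by the argument behind the structure theorem of Hopf modules: a
rational functional `f` with coaction `∑ f₀ ⊗ f₁` has the coinvariant `E(f)(x) = ∑ f₀(x S²(f₁))`,
and `f` is recovered from the integrals `E(f₀)` (`IsCoFrobenius.exists_isLeftIntegral`). The same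
idea shows that `λ(x S(h)) = 0` for all `x` only if `h = 0`; the antipode is surjective because `χ`
exists, and these two facts give nondegeneracy (`IsLeftIntegral.eq_of_mul_right`).

Computations use `sweedler k f h`, standing for `∑ f(h₁, h₂)`. Its integrand is an unbundled
function, whose linearity in each variable is left to `fun_prop`.
-/

open Coalgebra HopfAlgebra TensorProduct WithConv

noncomputable section

namespace CoFrobeniusHopf

attribute [fun_prop] IsLinearMap

/-! ### Linear functions -/

section Linear

variable {k M N : Type*} [Field k] [AddCommMonoid M] [Module k M] [AddCommMonoid N] [Module k N]
  {A : Type*} [Ring A] [Algebra k A] {P : Type*} [AddCommMonoid P] [Module k P]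

@[fun_prop] theorem isLinearMap_id : IsLinearMap k (fun x : M => x) :=
  ⟨fun _ _ => rfl, fun _ _ => rfl⟩

@[fun_prop] theorem isLinearMap_comp {f : N → P} {g : M → N} (hf : IsLinearMap k f)
    (hg : IsLinearMap k g) : IsLinearMap k (fun x => f (g x)) :=
  ⟨fun x y => by rw [hg.map_add, hf.map_add], fun c x => by rw [hg.map_smul, hf.map_smul]⟩

@[fun_prop] theorem isLinearMap_coe (f : M →ₗ[k] N) : IsLinearMap k (fun x => f x) :=
  f.isLinear

@[fun_prop] theorem isLinearMap_coe_fun (f : M →ₗ[k] N →ₗ[k] P) (y : N) :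
    IsLinearMap k (fun x => f x y) :=
  (f.flip y).isLinear

@[fun_prop] theorem isLinearMap_mul_const {f : M → A} (c : A) (hf : IsLinearMap k f) :
    IsLinearMap k (fun x => f x * c) :=
  ⟨fun x y => by rw [hf.map_add, add_mul], fun c x => by rw [hf.map_smul, smul_mul_assoc]⟩

@[fun_prop] theorem isLinearMap_const_mul {f : M → A} (c : A) (hf : IsLinearMap k f) :
    IsLinearMap k (fun x => c * f x) :=
  ⟨fun x y => by rw [hf.map_add, mul_add], fun c x => by rw [hf.map_smul, mul_smul_comm]⟩

@[fun_prop] theorem isLinearMap_smul_const {f : M → k} (c : N) (hf : IsLinearMap k f) :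
    IsLinearMap k (fun x => f x • c) :=
  ⟨fun x y => by rw [hf.map_add, add_smul], fun c x => by rw [hf.map_smul, smul_assoc]⟩

@[fun_prop] theorem isLinearMap_const_smul {f : M → N} (c : k) (hf : IsLinearMap k f) :
    IsLinearMap k (fun x => c • f x) :=
  ⟨fun x y => by rw [hf.map_add, smul_add], fun c x => by rw [hf.map_smul, smul_comm]⟩

@[fun_prop] theorem isLinearMap_sum {ι V W : Type*} [AddCommMonoid V] [Module k V] [AddCommMonoid W]
    [Module k W] (s : Finset ι) (F : ι → V → W) (hF : ∀ i, IsLinearMap k (F i)) :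
    IsLinearMap k (fun x => ∑ i ∈ s, F i x) :=
  ⟨fun a b => by simp only [(hF _).map_add, Finset.sum_add_distrib],
    fun c a => by simp only [(hF _).map_smul, Finset.smul_sum]⟩

@[fun_prop] theorem isLinearMap_eval {V W : Type*} [AddCommMonoid V] [Module k V]
    [AddCommMonoid W] [Module k W] (v : V) :
    IsLinearMap k (fun φ : V →ₗ[k] W => φ v) :=
  (LinearMap.applyₗ (R := k) (M₂ := W) v).isLinear

end Linear

/-! ### Sweedler sums -/

section Sweedler

variable {k H V W : Type*} [Field k] [Ring H] [HopfAlgebra k H]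
  [AddCommMonoid V] [Module k V] [AddCommMonoid W] [Module k W]

variable (k) in
/-- The Sweedler sum `∑ f(h₁, h₂)`, computed with a chosen expression of `Δ(h)` as a sum of pure
tensors. It is independent of that choice when `f` is bilinear, see `sweedler_eq_lift`. -/
def sweedler (f : H → H → V) (h : H) : V :=
  ∑ i ∈ (ℛ k h).index, f ((ℛ k h).left i) ((ℛ k h).right i)

/-- The bundled bilinear map of a function that is linear in each variable. -/
def bilin {M N : Type*} [AddCommMonoid M] [Module k M] [AddCommMonoid N] [Module k N]
    (f : M → N → V) (h₁ : ∀ y, IsLinearMap k (fun x => f x y))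
    (h₂ : ∀ x, IsLinearMap k (fun y => f x y)) : M →ₗ[k] N →ₗ[k] V :=
  LinearMap.mk₂ k f (fun x x' y => (h₁ y).map_add x x') (fun c x y => (h₁ y).map_smul c x)
    (fun x y y' => (h₂ x).map_add y y') (fun c x y => (h₂ x).map_smul c y)

theorem sweedler_eq_lift (f : H → H → V) (h₁ : ∀ y, IsLinearMap k (fun x => f x y))
    (h₂ : ∀ x, IsLinearMap k (fun y => f x y)) (h : H) :
    sweedler k f h = TensorProduct.lift (bilin f h₁ h₂) (comul h) := by
  rw [← (ℛ k h).eq, map_sum]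
  rfl

@[fun_prop] theorem isLinearMap_sweedler (f : W → H → H → V)
    (hf : ∀ x y, IsLinearMap k (fun z => f z x y)) (h : H) :
    IsLinearMap k (fun z => sweedler k (f z) h) :=
  ⟨fun a b => by simp only [sweedler, (hf _ _).map_add, Finset.sum_add_distrib],
    fun c a => by simp only [sweedler, (hf _ _).map_smul, Finset.smul_sum]⟩

@[fun_prop] theorem isLinearMap_sweedler_arg (f : H → H → V)
    (h₁ : ∀ y, IsLinearMap k (fun x => f x y))
    (h₂ : ∀ x, IsLinearMap k (fun y => f x y)) (g : W → H) (hg : IsLinearMap k g) :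
    IsLinearMap k (fun z => sweedler k f (g z)) :=
  ⟨fun a b => by simp only [sweedler_eq_lift f h₁ h₂, hg.map_add, map_add],
    fun c a => by simp only [sweedler_eq_lift f h₁ h₂, hg.map_smul, map_smul]⟩

theorem map_sweedler (g : V → W) (hg : IsLinearMap k g) (f : H → H → V) (h : H) :
    g (sweedler k f h) = sweedler k (fun x y => g (f x y)) h :=
  map_sum hg.mk' _ _

theorem map_sweedler_apply (g : V →ₗ[k] W) (f : H → H → V) (h : H) :
    g (sweedler k f h) = sweedler k (fun x y => g (f x y)) h :=
  map_sum g _ _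

theorem sweedler_congr {V : Type*} [AddCommMonoid V] {f g : H → H → V}
    (hfg : ∀ x y, f x y = g x y) (h : H) :
    sweedler k f h = sweedler k g h :=
  congrArg (fun F => sweedler k F h) (funext₂ hfg)

theorem sweedler_sum {ι V : Type*} [AddCommMonoid V] (s : Finset ι) (F : ι → H → H → V) (x : H) :
    sweedler k (fun a b => ∑ i ∈ s, F i a b) x = ∑ i ∈ s, sweedler k (F i) x :=
  Finset.sum_comm

theorem mul_sweedler {A : Type*} [Ring A] (c : A) (f : H → H → A) (h : H) :
    c * sweedler k f h = sweedler k (fun x y => c * f x y) h :=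
  Finset.mul_sum _ _ _

theorem sweedler_mul {A : Type*} [Ring A] (c : A) (f : H → H → A) (h : H) :
    sweedler k f h * c = sweedler k (fun x y => f x y * c) h :=
  Finset.sum_mul _ _ _

theorem smul_sweedler (c : k) (f : H → H → V) (h : H) :
    c • sweedler k f h = sweedler k (fun x y => c • f x y) h :=
  Finset.smul_sum

theorem sweedler_smul (c : V) (f : H → H → k) (h : H) :
    sweedler k f h • c = sweedler k (fun x y => f x y • c) h :=
  Finset.sum_smul

theorem sweedler_swap {V : Type*} [AddCommMonoid V] (f : H → H → H → H → V) (h l : H) :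
    sweedler k (fun x y => sweedler k (f x y) l) h =
      sweedler k (fun z w => sweedler k (fun x y => f x y z w) h) l :=
  Finset.sum_comm

/-- Coassociativity: `∑ f((h₁)₁, (h₁)₂, h₂) = ∑ f(h₁, (h₂)₁, (h₂)₂)`. -/
theorem sweedler_coassoc (f : H → H → H → V) (h₁ : ∀ y z, IsLinearMap k (fun x => f x y z))
    (h₂ : ∀ x z, IsLinearMap k (fun y => f x y z)) (h₃ : ∀ x y, IsLinearMap k (fun z => f x y z))
    (h : H) :
    sweedler k (fun p z => sweedler k (fun x y => f x y z) p) h =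
      sweedler k (fun x q => sweedler k (fun y z => f x y z) q) h := by
  have key := sum_tmul_tmul_eq (ℛ k h) (fun i => ℛ k ((ℛ k h).left i))
    (fun i => ℛ k ((ℛ k h).right i))
  let T : H →ₗ[k] H ⊗[k] H →ₗ[k] V :=
    bilin (fun x t => TensorProduct.lift (bilin (f x) (h₂ x) (h₃ x)) t)
      (fun t => by
        induction t using TensorProduct.induction_on with
        | zero => exact ⟨fun _ _ => by simp, fun _ _ => by simp⟩
        | tmul y z => simpa [bilin] using h₁ y z
        | add s t hs ht =>
          simp only [map_add]
          exact (hs.mk' + ht.mk').isLinear)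
      (fun x => LinearMap.isLinear _)
  have := congrArg (TensorProduct.lift T) key
  simp only [T, bilin, map_sum, lift.tmul, LinearMap.mk₂_apply] at this
  exact this

/-- Both sides are `∑ f(h₁, h₂, h₃, h₄)`: the bracketing `(12)(34)` against `1((23)4)`. -/
theorem sweedler_coassoc_middle (f : H → H → H → H → V)
    (h₁ : ∀ y z w, IsLinearMap k (fun x => f x y z w))
    (h₂ : ∀ x z w, IsLinearMap k (fun y => f x y z w))
    (h₃ : ∀ x y w, IsLinearMap k (fun z => f x y z w))
    (h₄ : ∀ x y z, IsLinearMap k (fun w => f x y z w)) (h : H) :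
    sweedler k (fun p q => sweedler k (fun x y => sweedler k (fun z w => f x y z w) q) p) h =
      sweedler k (fun x r => sweedler k (fun t w => sweedler k (fun y z => f x y z w) t) r) h :=
  (sweedler_coassoc (fun x y q => sweedler k (fun z w => f x y z w) q)
      (by fun_prop) (by fun_prop) (by fun_prop) h).trans
    (sweedler_congr (fun x r => (sweedler_coassoc (fun y z w => f x y z w)
      (by fun_prop) (by fun_prop) (by fun_prop) r).symm) h)

theorem sweedler_counit_left (f : H → V) (hf : IsLinearMap k f) (h : H) :
    sweedler k (fun x y => (counit x : k) • f y) h = f h := by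
  simpa only [hf.map_smul] using (map_sweedler f hf _ h).symm.trans
    (congrArg f (show sweedler k (fun x y => (counit x : k) • y) h = h from
      sum_counit_smul (ℛ k h)))

theorem sweedler_counit_right (f : H → V) (hf : IsLinearMap k f) (h : H) :
    sweedler k (fun x y => (counit y : k) • f x) h = f h := by
  have := congrArg (TensorProduct.rid k H) (sum_tmul_counit_eq (ℛ k h))
  simp only [map_sum, TensorProduct.rid_tmul, one_smul] at this
  simpa only [hf.map_smul] using (map_sweedler f hf _ h).symm.trans (congrArg f
    (show sweedler k (fun x y => (counit y : k) • x) h = h from this))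

theorem sweedler_antipode_mul (f : H → V) (hf : IsLinearMap k f) (h : H) :
    sweedler k (fun x y => f (antipode k x * y)) h = (counit h : k) • f 1 := by
  rw [← map_sweedler f hf, ← hf.map_smul]
  exact congrArg f (sum_antipode_mul_eq_smul (ℛ k h))

theorem sweedler_mul_antipode (f : H → V) (hf : IsLinearMap k f) (h : H) :
    sweedler k (fun x y => f (x * antipode k y)) h = (counit h : k) • f 1 := by
  rw [← map_sweedler f hf, ← hf.map_smul]
  exact congrArg f (sum_mul_antipode_eq_smul (ℛ k h))

theorem sweedler_of_mul (f : H → H → V) (h₁ : ∀ y, IsLinearMap k (fun x => f x y))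
    (h₂ : ∀ x, IsLinearMap k (fun y => f x y)) (h l : H) :
    sweedler k f (h * l) =
      sweedler k (fun x y => sweedler k (fun z w => f (x * z) (y * w)) l) h := by
  rw [sweedler_eq_lift f h₁ h₂, Bialgebra.comul_mul, ← (ℛ k h).eq, ← (ℛ k l).eq]
  simp [Finset.sum_mul_sum, map_sum, sweedler, bilin]

theorem sweedler_of_groupLike (f : H → H → V) (h₁ : ∀ y, IsLinearMap k (fun x => f x y))
    (h₂ : ∀ x, IsLinearMap k (fun y => f x y)) {g : H} (hg : IsGroupLikeElem k g) :
    sweedler k f g = f g g := by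
  rw [sweedler_eq_lift f h₁ h₂, hg.comul_eq_tmul_self]
  simp [bilin]

theorem sweedler_tmul (h : H) : sweedler k (fun x y => x ⊗ₜ[k] y) h = comul h := (ℛ k h).eq

@[fun_prop] theorem isLinearMap_tmul_left {M : Type*} [AddCommMonoid M] [Module k M] (f : W → V)
    (hf : IsLinearMap k f) (y : M) : IsLinearMap k (fun x => f x ⊗ₜ[k] y) :=
  ⟨fun a b => by rw [hf.map_add, add_tmul], fun c a => by rw [hf.map_smul, smul_tmul']⟩

@[fun_prop] theorem isLinearMap_tmul_right {M : Type*} [AddCommMonoid M] [Module k M] (f : W → V)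
    (hf : IsLinearMap k f) (y : M) : IsLinearMap k (fun x => y ⊗ₜ[k] f x) :=
  ⟨fun a b => by rw [hf.map_add, tmul_add], fun c a => by rw [hf.map_smul, tmul_smul]⟩

theorem convMul_apply_eq_sweedler {A : Type*} [Ring A] [Algebra k A] (p q : H →ₗ[k] A) (h : H) :
    (toConv p * toConv q) h = sweedler k (fun x y => p x * q y) h :=
  (ℛ k h).convMul_apply _ _

theorem ofConv_convMul_apply (p q : H →ₗ[k] k) (h : H) :
    (toConv p * toConv q).ofConv h = sweedler k (fun x y => p x * q y) h :=
  convMul_apply_eq_sweedler p q h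

theorem convMul_apply_tmul_eq_sweedler (P Q : H ⊗[k] H →ₗ[k] H) (h l : H) :
    (toConv P * toConv Q) (h ⊗ₜ[k] l) =
      sweedler k (fun x y => sweedler k (fun z w => P (x ⊗ₜ z) * Q (y ⊗ₜ w)) l) h := by
  rw [((ℛ k h).tmul (ℛ k l)).convMul_apply]
  exact Finset.sum_product _ _ _

/-- The antipode is a coalgebra anti-homomorphism: `(h ↦ S(h₂) ⊗ S(h₁))` and `Δ ∘ S` are a left
and a right convolution inverse of `Δ`. -/
theorem comul_antipode (h : H) :
    comul (antipode k h) = sweedler k (fun x y => antipode k y ⊗ₜ[k] antipode k x) h := by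
  let G : H →ₗ[k] H ⊗[k] H := IsLinearMap.mk'
    (fun h => sweedler k (fun x y => antipode k y ⊗ₜ[k] antipode k x) h) (by fun_prop)
  have hG : toConv G * toConv (comul : H →ₗ[k] H ⊗[k] H) = 1 := by
    ext h
    have h1 (x y z : H) : sweedler k (fun p q =>
        (antipode k p * q) ⊗ₜ[k] (antipode k x * z)) y =
        (counit y : k) • ((1 : H) ⊗ₜ[k] (antipode k x * z)) :=
      sweedler_antipode_mul (fun y => y ⊗ₜ[k] (antipode k x * z)) (by fun_prop) y
    have h2 (x y : H) : sweedler k (fun z w => sweedler k (fun p q =>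
        (antipode k p * q) ⊗ₜ[k] (antipode k x * w)) z) y =
        (1 : H) ⊗ₜ[k] (antipode k x * y) := by
      simp only [h1]
      exact sweedler_counit_left (fun z => (1 : H) ⊗ₜ[k] (antipode k x * z)) (by fun_prop) y
    calc (toConv G * toConv (comul : H →ₗ[k] H ⊗[k] H)) h
        = sweedler k (fun u y => sweedler k (fun x p => sweedler k (fun z w =>
          (antipode k p * z) ⊗ₜ[k] (antipode k x * w)) y) u) h := by
          rw [convMul_apply_eq_sweedler]
          simp only [G, IsLinearMap.mk'_apply, ← sweedler_tmul, sweedler_mul, mul_sweedler,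
            Algebra.TensorProduct.tmul_mul_tmul]
          exact congrArg (fun F => sweedler k F h) (funext₂ fun x y => sweedler_swap _ _ _)
      _ = sweedler k (fun x y => sweedler k (fun p q => sweedler k (fun z w =>
          (antipode k p * z) ⊗ₜ[k] (antipode k x * w)) q) y) h :=
          sweedler_coassoc _ (by fun_prop) (by fun_prop) (by fun_prop) h
      _ = sweedler k (fun x y => sweedler k (fun z w => sweedler k (fun p q =>
          (antipode k p * q) ⊗ₜ[k] (antipode k x * w)) z) y) h := by
          refine congrArg (fun F => sweedler k F h) (funext₂ fun x y => ?_)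
          exact (sweedler_coassoc (fun p q w => (antipode k p * q) ⊗ₜ[k] (antipode k x * w))
            (by fun_prop) (by fun_prop) (by fun_prop) y).symm
      _ = (counit h : k) • ((1 : H) ⊗ₜ[k] (1 : H)) := by
          simp only [h2]
          exact sweedler_antipode_mul (fun z => (1 : H) ⊗ₜ[k] z) (by fun_prop) h
      _ = (1 : WithConv (H →ₗ[k] H ⊗[k] H)) h := by
          rw [LinearMap.convOne_apply, Algebra.algebraMap_eq_smul_one,
            Algebra.TensorProduct.one_def]
  have := left_inv_eq_right_inv hG (LinearMap.comul_right_inv (R := k) (C := H))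
  exact (LinearMap.congr_fun (WithConv.toConv_injective this) h).symm

theorem sweedler_of_antipode (f : H → H → V) (h₁ : ∀ y, IsLinearMap k (fun x => f x y))
    (h₂ : ∀ x, IsLinearMap k (fun y => f x y)) (h : H) :
    sweedler k f (antipode k h) = sweedler k (fun x y => f (antipode k y) (antipode k x)) h := by
  rw [sweedler_eq_lift f h₁ h₂, comul_antipode]
  exact map_sum _ _ _

end Sweedler

/-! ### Coquasitriangular structures -/

section Coquasitriangular

variable {k H : Type*} [Field k] [Ring H] [HopfAlgebra k H]
  {σ : H →ₗ[k] H →ₗ[k] k}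

namespace IsCoquasitriangular

theorem mul_left_sweedler (hσ : IsCoquasitriangular σ) (h l m : H) :
    σ (h * l) m = sweedler k (fun x y => σ h x * σ l y) m :=
  (hσ.mul_left h l m).trans (convMul_apply_eq_sweedler _ _ _)

theorem mul_right_sweedler (hσ : IsCoquasitriangular σ) (h l m : H) :
    σ h (l * m) = sweedler k (fun x y => σ x m * σ y l) h :=
  (hσ.mul_right h l m).trans (convMul_apply_eq_sweedler _ _ _)

theorem comm_sweedler (hσ : IsCoquasitriangular σ) (h l : H) :
    sweedler k (fun x y => sweedler k (fun z w => σ y w • (z * x)) l) h =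
      sweedler k (fun x y => sweedler k (fun z w => σ x z • (y * w)) l) h := by
  have := LinearMap.congr_fun (congrArg ofConv hσ.comm) (h ⊗ₜ[k] l)
  have e := convMul_apply_tmul_eq_sweedler (k := k) (H := H)
  refine ((e _ _ h l).symm.trans this).trans (e _ _ h l) |> fun q => ?_
  simpa [Algebra.algebraMap_eq_smul_one] using q

/-- `σ(S(h), S(l)) = σ(h, l)`: both are convolution inverse to `σ(S(h), l)`. -/
theorem antipode_antipode (hσ : IsCoquasitriangular σ) (h l : H) :
    σ (antipode k h) (antipode k l) = σ h l := by
  -- `∑ σ(h₁, l₁) σ(S(h₂), l₂) σ(S(h₃), S(l₃))`, contracted in two ways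
  have e1 (h l : H) : sweedler k (fun x y => sweedler k (fun z w =>
      σ x z * σ (antipode k y) w) l) h = counit h * counit l := by
    simp only [← hσ.mul_left_sweedler]
    rw [sweedler_mul_antipode (k := k) (fun x => σ x l) (by fun_prop), hσ.left_one, smul_eq_mul]
  have e2 (h l : H) : sweedler k (fun x y => sweedler k (fun z w =>
      σ (antipode k x) z * σ (antipode k y) (antipode k w)) l) h = counit h * counit l := by
    rw [sweedler_swap]
    have (z w : H) : sweedler k (fun x y => σ (antipode k x) z *
        σ (antipode k y) (antipode k w)) h = σ (antipode k h) (z * antipode k w) := by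
      rw [hσ.mul_right_sweedler, sweedler_of_antipode _ (by fun_prop) (by fun_prop)]
      exact sweedler_congr (fun x y => mul_comm _ _) h
    simp only [this]
    rw [sweedler_mul_antipode (k := k) (fun x => σ (antipode k h) x) (by fun_prop), hσ.right_one,
      smul_eq_mul, counit_antipode, mul_comm]
  have e3 : sweedler k (fun p y => sweedler k (fun q w => sweedler k (fun x x' =>
      sweedler k (fun z z' => σ x z * σ (antipode k x') z') q) p *
        σ (antipode k y) (antipode k w)) l) h =
      sweedler k (fun x q => sweedler k (fun z r => σ x z * sweedler k (fun y y' =>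
      sweedler k (fun w w' => σ (antipode k y) w * σ (antipode k y') (antipode k w')) r) q)
      l) h := by
    simp only [sweedler_mul, mul_sweedler]
    calc _ = sweedler k (fun p y => sweedler k (fun x x' => sweedler k (fun q w =>
        sweedler k (fun z z' => σ x z * σ (antipode k x') z' *
          σ (antipode k y) (antipode k w)) q) l) p) h :=
          sweedler_congr (fun p y => sweedler_swap _ _ _) h
      _ = sweedler k (fun x q => sweedler k (fun y y' => sweedler k (fun z r =>
        sweedler k (fun w w' => σ x z * σ (antipode k y) w *
          σ (antipode k y') (antipode k w')) r) l) q) h := by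
          rw [sweedler_coassoc (fun x x' y => sweedler k (fun q w =>
            sweedler k (fun z z' => σ x z * σ (antipode k x') z' *
              σ (antipode k y) (antipode k w)) q) l) (by fun_prop) (by fun_prop) (by fun_prop)]
          refine sweedler_congr (fun x q => sweedler_congr (fun y y' => ?_) q) h
          exact sweedler_coassoc _ (by fun_prop) (by fun_prop) (by fun_prop) l
      _ = _ := by
          refine sweedler_congr (fun x q => ?_) h
          simp only [mul_assoc]
          exact sweedler_swap _ _ _
  simp only [e1, e2] at e3
  have l1 (p y : H) : sweedler k (fun q w => counit p * counit q *
      σ (antipode k y) (antipode k w)) l = counit p * σ (antipode k y) (antipode k l) := by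
    simpa only [mul_assoc, smul_eq_mul, mul_left_comm] using sweedler_counit_left (k := k)
      (fun w => counit p * σ (antipode k y) (antipode k w)) (by fun_prop) l
  have r1 (x q : H) : sweedler k (fun z r => σ x z * (counit q * counit r)) l =
      counit q * σ x l := by
    have := sweedler_counit_right (k := k) (fun z => counit q * σ x z) (by fun_prop) l
    simp only [smul_eq_mul] at this
    rw [← this]
    exact sweedler_congr (fun z r => by ring) l
  simp only [l1, r1] at e3
  have l2 := sweedler_counit_left (k := k) (fun y => σ (antipode k y) (antipode k l))
    (by fun_prop) h
  have r2 := sweedler_counit_right (k := k) (fun x => σ x l) (by fun_prop) h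
  simp only [smul_eq_mul] at l2 r2
  exact (l2.symm.trans e3).trans r2

end IsCoquasitriangular

theorem drinfeldU_apply (σ : H →ₗ[k] H →ₗ[k] k) (h : H) :
    drinfeldU σ h = sweedler k (fun x y => σ y (antipode k x)) h := by
  simp only [drinfeldU, LinearMap.comp_apply]
  rw [← (ℛ k h).eq, map_sum, map_sum]
  rfl

namespace IsCoquasitriangular

theorem drinfeldV_apply (hσ : IsCoquasitriangular σ) (h : H) :
    drinfeldV σ h = sweedler k (fun x y => σ x (antipode k y)) h := by
  rw [drinfeldV, LinearMap.comp_apply, drinfeldU_apply,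
    sweedler_of_antipode _ (by fun_prop) (by fun_prop)]
  simp only [hσ.antipode_antipode]

/-- `∑ u(h₂) h₃ S(h₁) = u(h) 1`, the commutation relation of `σ` at `h₂ ⊗ S(h₁)`. -/
theorem drinfeldU_smul_mul_antipode (hσ : IsCoquasitriangular σ) (h : H) :
    sweedler k (fun x r => sweedler k (fun t y => drinfeldU σ t • (y * antipode k x)) r) h =
      drinfeldU σ h • (1 : H) := by
  have key : sweedler k (fun p q => sweedler k (fun a b => sweedler k (fun c d =>
      σ d (antipode k a) • (antipode k b * c)) q) p) h =
      sweedler k (fun p q => sweedler k (fun a b => sweedler k (fun c d =>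
      σ c (antipode k b) • (d * antipode k a)) q) p) h := by
    refine sweedler_congr (fun p q => ?_) h
    have := hσ.comm_sweedler q (antipode k p)
    rw [sweedler_swap, sweedler_swap (k := k) _ q,
      sweedler_of_antipode _ (by fun_prop) (by fun_prop),
      sweedler_of_antipode _ (by fun_prop) (by fun_prop)] at this
    exact this
  rw [sweedler_coassoc_middle _ (by fun_prop) (by fun_prop) (by fun_prop) (by fun_prop),
    sweedler_coassoc_middle _ (by fun_prop) (by fun_prop) (by fun_prop) (by fun_prop)] at key
  simp only [drinfeldU_apply, sweedler_smul]
  rw [← key]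
  refine sweedler_congr (fun a r => ?_) h
  have (d t : H) := sweedler_antipode_mul (k := k) (fun y => σ d (antipode k a) • y) (by fun_prop) t
  simp only [this]
  exact sweedler_counit_left (k := k) (fun d => σ d (antipode k a) • (1 : H)) (by fun_prop) r

/-- `∑ S²(h₁) u(h₂) = ∑ u(h₁) h₂`: conjugation by `u` is the square of the antipode. -/
theorem drinfeldU_smul_antipode_antipode (hσ : IsCoquasitriangular σ) (h : H) :
    sweedler k (fun x y => drinfeldU σ y • antipode k (antipode k x)) h =
      sweedler k (fun x y => drinfeldU σ x • y) h := by
  have e (x y : H) : drinfeldU σ y • antipode k (antipode k x) =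
      sweedler k (fun a r => sweedler k (fun t d =>
        drinfeldU σ t • (d * antipode k (antipode k x * a))) r) y := by
    have := congrArg (· * antipode k (antipode k x)) (hσ.drinfeldU_smul_mul_antipode y)
    simp only [sweedler_mul, smul_mul_assoc, one_mul, mul_assoc,
      ← antipode_mul_antidistrib] at this
    exact this.symm
  simp only [e]
  rw [← sweedler_coassoc (fun x a r => sweedler k (fun t d =>
    drinfeldU σ t • (d * antipode k (antipode k x * a))) r)
    (by fun_prop) (by fun_prop) (by fun_prop)]
  have (p r : H) := sweedler_antipode_mul (k := k) (fun y => sweedler k (fun t d =>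
    drinfeldU σ t • (d * antipode k y)) r) (by fun_prop) p
  simp only [this, antipode_one, mul_one]
  exact sweedler_counit_left (k := k) (fun r => sweedler k (fun t d => drinfeldU σ t • d) r)
    (by fun_prop) h

/-- `∑ u(h₂) σ(h₃, h₁) = ε(h)`, since `∑ σ(h₃, S(h₂)) σ(h₄, h₁) = ∑ σ(h₃, h₁ S(h₂))`. -/
theorem drinfeldU_mul_sigma (hσ : IsCoquasitriangular σ) (h : H) :
    sweedler k (fun x r => sweedler k (fun t y => drinfeldU σ t * σ y x) r) h =
      (counit h : k) := by
  simp only [drinfeldU_apply, sweedler_mul]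
  rw [← sweedler_coassoc_middle (fun x b c y => σ c (antipode k b) * σ y x)
    (by fun_prop) (by fun_prop) (by fun_prop) (by fun_prop)]
  simp only [← hσ.mul_right_sweedler]
  have (p q : H) := sweedler_mul_antipode (k := k) (fun y => σ q y) (by fun_prop) p
  simp only [this, hσ.right_one]
  exact sweedler_counit_left (k := k) (fun y => (counit y : k)) (by fun_prop) h

/-- The functional `u` is convolution invertible, with inverse `h ↦ ∑ σ(S²(h₂), h₁)`. -/
theorem exists_unit_drinfeldU (hσ : IsCoquasitriangular σ) :
    ∃ u : (WithConv (H →ₗ[k] k))ˣ, (u : WithConv (H →ₗ[k] k)) = toConv (drinfeldU σ) := by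
  let w : H →ₗ[k] k := IsLinearMap.mk'
    (fun h => sweedler k (fun x y => σ (antipode k (antipode k y)) x) h) (by fun_prop)
  have e (g : H →ₗ[k] k) (h : H) := congrArg g (hσ.drinfeldU_smul_antipode_antipode h)
  simp only [map_sweedler _ (isLinearMap_coe _), map_smul, smul_eq_mul] at e
  refine ⟨⟨toConv (drinfeldU σ), toConv w, ?_, ?_⟩, rfl⟩
  · ext h
    rw [convMul_apply_eq_sweedler]
    simp only [w, IsLinearMap.mk'_apply, mul_sweedler]
    rw [← sweedler_coassoc (fun p x y => drinfeldU σ p * σ (antipode k (antipode k y)) x)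
      (by fun_prop) (by fun_prop) (by fun_prop)]
    simp only [← e, hσ.antipode_antipode]
    rw [sweedler_coassoc (fun p x y => drinfeldU σ x * σ y p)
      (by fun_prop) (by fun_prop) (by fun_prop)]
    exact hσ.drinfeldU_mul_sigma h
  · ext h
    rw [convMul_apply_eq_sweedler]
    simp only [w, IsLinearMap.mk'_apply, sweedler_mul]
    rw [sweedler_coassoc (fun x y q => σ (antipode k (antipode k y)) x * drinfeldU σ q)
      (by fun_prop) (by fun_prop) (by fun_prop)]
    have e' (x r : H) := e (σ.flip x) r
    simp only [LinearMap.flip_apply] at e'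
    simp only [mul_comm _ (drinfeldU σ _), e']
    exact hσ.drinfeldU_mul_sigma h

end IsCoquasitriangular

theorem convMul_comp_antipode (γ : H →ₐ[k] k) :
    toConv γ.toLinearMap * toConv (γ.toLinearMap ∘ₗ antipode k) = 1 := by
  ext h
  rw [convMul_apply_eq_sweedler]
  simp only [LinearMap.comp_apply, AlgHom.toLinearMap_apply, ← map_mul]
  rw [sweedler_mul_antipode (k := k) (fun x => γ x) γ.toLinearMap.isLinear]
  simp

/-- Characters of `H` commute with `u` under convolution. -/
theorem IsCoquasitriangular.commute_algHom_drinfeldU (hσ : IsCoquasitriangular σ)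
    (γ : H →ₐ[k] k) :
    toConv γ.toLinearMap * toConv (drinfeldU σ) = toConv (drinfeldU σ) * toConv γ.toLinearMap := by
  have : toConv (γ.toLinearMap ∘ₗ antipode k) * (toConv (drinfeldU σ) * toConv γ.toLinearMap) =
      toConv (drinfeldU σ) := by
    ext h
    have e := congrArg γ.toLinearMap (hσ.drinfeldU_smul_mul_antipode h)
    simp only [map_sweedler _ (isLinearMap_coe _), map_smul, smul_eq_mul, AlgHom.toLinearMap_apply,
      map_mul, map_one, mul_one] at e
    refine (convMul_apply_eq_sweedler _ (toConv (drinfeldU σ) * toConv γ.toLinearMap).ofConv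
      h).trans (Eq.trans ?_ e)
    refine sweedler_congr (fun x r => ?_) h
    rw [show (toConv (drinfeldU σ) * toConv γ.toLinearMap).ofConv r = _ from
      convMul_apply_eq_sweedler _ _ _, mul_sweedler]
    refine sweedler_congr (fun t y => ?_) r
    simp only [LinearMap.comp_apply, AlgHom.toLinearMap_apply]
    ring
  rw [← this, ← mul_assoc, convMul_comp_antipode, one_mul, this]

end Coquasitriangular

/-! ### Moving tensor legs across a product -/

section Transport

variable {k H V : Type*} [Field k] [Ring H] [HopfAlgebra k H] [AddCommMonoid V] [Module k V]

/-- `∑ F(x₁, x₂ S(h)) = ∑ F((x S(h₁))₁ h₂, (x S(h₁))₂)`. -/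
theorem sweedler_apply_mul_antipode (F : H → H → V) (h₁ : ∀ y, IsLinearMap k (fun x => F x y))
    (h₂ : ∀ x, IsLinearMap k (fun y => F x y)) (x h : H) :
    sweedler k (fun a b => F a (b * antipode k h)) x =
      sweedler k (fun s t => sweedler k (fun a b => F (a * t) b) (x * antipode k s)) h := by
  have e (s t : H) : sweedler k (fun a b => F (a * t) b) (x * antipode k s) =
      sweedler k (fun c d => sweedler k (fun a b =>
        F (a * (antipode k d * t)) (b * antipode k c)) x) s := by
    rw [sweedler_of_mul _ (by fun_prop) (by fun_prop), sweedler_swap,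
      sweedler_of_antipode _ (by fun_prop) (by fun_prop)]
    simp only [mul_assoc]
  simp only [e]
  rw [sweedler_coassoc (fun c d t => sweedler k (fun a b =>
    F (a * (antipode k d * t)) (b * antipode k c)) x)
    (by fun_prop) (by fun_prop) (by fun_prop)]
  have e' (c r : H) := sweedler_antipode_mul (k := k) (fun z => sweedler k (fun a b =>
    F (a * z) (b * antipode k c)) x) (by fun_prop) r
  simp only [e', mul_one]
  exact (sweedler_counit_right (k := k) (fun c => sweedler k (fun a b =>
    F a (b * antipode k c)) x) (by fun_prop) h).symm

/-- `∑ F(l₁, m l₂) = ∑ F(S(m₁) (m₂ l)₁, (m₂ l)₂)`. -/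
theorem sweedler_apply_mul_left (F : H → H → V) (h₁ : ∀ y, IsLinearMap k (fun x => F x y))
    (h₂ : ∀ x, IsLinearMap k (fun y => F x y)) (m l : H) :
    sweedler k (fun a b => F a (m * b)) l =
      sweedler k (fun c d => sweedler k (fun a b => F (antipode k c * a) b) (d * l)) m := by
  have e (c d : H) : sweedler k (fun a b => F (antipode k c * a) b) (d * l) =
      sweedler k (fun p q => sweedler k (fun a b =>
        F (antipode k c * p * a) (q * b)) l) d := by
    rw [sweedler_of_mul _ (by fun_prop) (by fun_prop)]
    simp only [mul_assoc]
  simp only [e]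
  rw [← sweedler_coassoc (fun c p q => sweedler k (fun a b =>
    F (antipode k c * p * a) (q * b)) l) (by fun_prop) (by fun_prop) (by fun_prop)]
  have e' (q r : H) := sweedler_antipode_mul (k := k) (fun z => sweedler k (fun a b =>
    F (z * a) (q * b)) l) (by fun_prop) r
  simp only [e', one_mul]
  exact (sweedler_counit_left (k := k) (fun q => sweedler k (fun a b =>
    F a (q * b)) l) (by fun_prop) m).symm

/-- `∑ F(l₁ h, l₂) = ∑ F((l h₁)₁, (l h₁)₂ S(h₂))`. -/
theorem sweedler_apply_mul_right (F : H → H → V) (h₁ : ∀ y, IsLinearMap k (fun x => F x y))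
    (h₂ : ∀ x, IsLinearMap k (fun y => F x y)) (l h : H) :
    sweedler k (fun a b => F (a * h) b) l =
      sweedler k (fun c d => sweedler k (fun a b => F a (b * antipode k d)) (l * c)) h := by
  have e (c d : H) : sweedler k (fun a b => F a (b * antipode k d)) (l * c) =
      sweedler k (fun p q => sweedler k (fun a b =>
        F (a * p) (b * (q * antipode k d))) l) c := by
    rw [sweedler_of_mul _ (by fun_prop) (by fun_prop), sweedler_swap]
    simp only [mul_assoc]
  simp only [e]
  rw [sweedler_coassoc (fun p q d => sweedler k (fun a b =>
    F (a * p) (b * (q * antipode k d))) l) (by fun_prop) (by fun_prop) (by fun_prop)]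
  have e' (p r : H) := sweedler_mul_antipode (k := k) (fun z => sweedler k (fun a b =>
    F (a * p) (b * z)) l) (by fun_prop) r
  simp only [e', mul_one]
  exact (sweedler_counit_right (k := k) (fun p => sweedler k (fun a b =>
    F (a * p) b) l) (by fun_prop) h).symm

/-- `∑ F(S(l) h₁, h₂) = ∑ F((S(l₂) h)₁, l₁ (S(l₂) h)₂)`. -/
theorem sweedler_apply_antipode_mul (F : H → H → V) (h₁ : ∀ y, IsLinearMap k (fun x => F x y))
    (h₂ : ∀ x, IsLinearMap k (fun y => F x y)) (l h : H) :
    sweedler k (fun a b => F (antipode k l * a) b) h =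
      sweedler k (fun c d => sweedler k (fun a b => F a (c * b)) (antipode k d * h)) l := by
  have e (c d : H) : sweedler k (fun a b => F a (c * b)) (antipode k d * h) =
      sweedler k (fun p q => sweedler k (fun a b =>
        F (antipode k q * a) (c * antipode k p * b)) h) d := by
    rw [sweedler_of_mul _ (by fun_prop) (by fun_prop),
      sweedler_of_antipode _ (by fun_prop) (by fun_prop)]
    simp only [mul_assoc]
  simp only [e]
  rw [← sweedler_coassoc (fun c p q => sweedler k (fun a b =>
    F (antipode k q * a) (c * antipode k p * b)) h) (by fun_prop) (by fun_prop) (by fun_prop)]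
  have e' (q r : H) := sweedler_mul_antipode (k := k) (fun z => sweedler k (fun a b =>
    F (antipode k q * a) (z * b)) h) (by fun_prop) r
  simp only [e', one_mul]
  exact (sweedler_counit_left (k := k) (fun q => sweedler k (fun a b =>
    F (antipode k q * a) b) h) (by fun_prop) l).symm

end Transport

/-! ### Tensors with values in a space of linear maps -/

section Contraction

variable {k U V W : Type*} [Field k] [AddCommMonoid U] [Module k U] [AddCommMonoid V] [Module k V]
  [AddCommMonoid W] [Module k W] [Module.Free k W]

/-- The canonical map `Hom(U, V) ⊗ W → Hom(U, V ⊗ W)` is injective. Hence an identity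
`∑ φᵢ(u) ⊗ wᵢ = ∑ ψⱼ(u) ⊗ wⱼ'` for all `u` may be evaluated with `u` depending on the second leg. -/
theorem eq_of_rTensor_applyₗ_eq {s t : (U →ₗ[k] V) ⊗[k] W}
    (h : ∀ u, (LinearMap.applyₗ (R := k) (M₂ := V) u).rTensor W s =
      (LinearMap.applyₗ u).rTensor W t) : s = t := by
  let b := Module.Free.chooseBasis k W
  have e (s : (U →ₗ[k] V) ⊗[k] W) (u : U) (i) :
      (TensorProduct.equivFinsuppOfBasisRight b s i) u =
        TensorProduct.equivFinsuppOfBasisRight b ((LinearMap.applyₗ u).rTensor W s) i := by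
    induction s using TensorProduct.induction_on with
    | zero => simp
    | tmul φ w => simp
    | add s t hs ht => simp [hs, ht]
  apply (TensorProduct.equivFinsuppOfBasisRight b).injective
  ext i u
  rw [e, e, h]

theorem eq_of_forall_dual {V : Type*} [AddCommGroup V] [Module k V] {v w : V}
    (h : ∀ p : V →ₗ[k] k, p v = p w) : v = w :=
  sub_eq_zero.1 ((Module.forall_dual_apply_eq_zero_iff k _).1 fun p => by
    rw [map_sub, h, sub_self])

end Contraction

/-! ### Existence of integrals -/

section Integral

variable {k H : Type*} [Field k] [Ring H] [HopfAlgebra k H]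

theorem isLeftIntegral_iff {lam : H →ₗ[k] k} :
    IsLeftIntegral lam ↔ ∀ h : H, sweedler k (fun x y => lam y • x) h = lam h • (1 : H) := by
  have e (p : H →ₗ[k] k) (h : H) : (toConv p * toConv lam) h =
      p (sweedler k (fun x y => lam y • x) h) := by
    rw [convMul_apply_eq_sweedler, map_sweedler _ (isLinearMap_coe p)]
    exact sweedler_congr (fun x y => by simp [mul_comm]) h
  constructor
  · intro hl h
    refine eq_of_forall_dual (k := k) (fun p => ?_)
    rw [← e, hl p, map_smul, smul_eq_mul, mul_comm]
    rfl
  · intro hl p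
    ext h
    exact (e p h).trans (by rw [hl, map_smul, smul_eq_mul, mul_comm]; rfl)

/-- The rational coaction takes `f` to `∑ gᵢ ⊗ hᵢ`. This is the equation `∑ f(x₂) x₁ = ∑ gᵢ(x) hᵢ`
in `H`, which is `p * f = ∑ p(hᵢ) gᵢ` for all functionals `p`. -/
def IsCoaction {ι : Type*} (s : Finset ι) (h : ι → H) (g : ι → H →ₗ[k] k) (f : H →ₗ[k] k) : Prop :=
  ∀ x : H, sweedler k (fun a b => f b • a) x = ∑ i ∈ s, g i x • h i

theorem IsRational.exists_isCoaction {f : H →ₗ[k] k} (hf : IsRational f) :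
    ∃ (n : ℕ) (h : Fin n → H) (g : Fin n → H →ₗ[k] k), IsCoaction Finset.univ h g f := by
  obtain ⟨n, h, g, hp⟩ := hf
  refine ⟨n, h, g, fun x => eq_of_forall_dual (k := k) fun p => ?_⟩
  have := congrArg (fun F : WithConv (H →ₗ[k] k) => F x) (hp p)
  simp only [convMul_apply_eq_sweedler] at this
  rw [map_sweedler _ (isLinearMap_coe p), map_sum]
  simp only [map_smul, smul_eq_mul]
  refine (sweedler_congr (fun a b => mul_comm _ _) x).trans (this.trans ?_)
  simp [LinearMap.sum_apply, mul_comm]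

variable {ι : Type*} {s : Finset ι} {h : ι → H} {g : ι → H →ₗ[k] k} {f : H →ₗ[k] k}

/-- Coassociativity of the coaction: `∑ gᵢ(x) Δ(hᵢ) = ∑ gᵢ(x₂) x₁ ⊗ hᵢ`. -/
theorem IsCoaction.comul (hf : IsCoaction s h g f) (x : H) :
    ∑ i ∈ s, g i x • (CoalgebraStruct.comul (h i) : H ⊗[k] H) =
      ∑ i ∈ s, sweedler k (fun a b => g i b • (a ⊗ₜ[k] h i)) x := by
  have := congrArg (CoalgebraStruct.comul : H →ₗ[k] H ⊗[k] H) (hf x)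
  rw [map_sweedler _ (isLinearMap_coe _), map_sum] at this
  simp only [map_smul] at this
  rw [← this]
  simp only [← sweedler_tmul, smul_sweedler]
  rw [sweedler_coassoc (fun a b z => f z • (a ⊗ₜ[k] b)) (by fun_prop) (by fun_prop) (by fun_prop),
    ← sweedler_sum]
  refine sweedler_congr (fun a q => ?_) x
  have := congrArg (fun y => a ⊗ₜ[k] y) (hf q)
  simp only [tmul_sum, tmul_smul] at this
  rw [← this, map_sweedler (k := k) (fun y => a ⊗ₜ[k] y) (by fun_prop)]
  simp only [tmul_smul]

theorem IsCoaction.sum_counit (hf : IsCoaction s h g f) (x : H) :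
    ∑ i ∈ s, g i x * counit (h i) = f x := by
  have := congrArg (counit : H →ₗ[k] k) (hf x)
  rw [map_sweedler _ (isLinearMap_coe _), map_sum] at this
  simp only [map_smul, smul_eq_mul] at this
  rw [← this]
  simpa only [smul_eq_mul, mul_comm] using sweedler_counit_left (k := k) (fun y => f y)
    (by fun_prop) x

/-- The coaction on `q * f`. -/
theorem IsCoaction.convMul (hf : IsCoaction s h g f) (q : H →ₗ[k] k) :
    IsCoaction (s.sigma fun i => (ℛ k (h i)).index) (fun j => (ℛ k (h j.1)).left j.2)
      (fun j => q ((ℛ k (h j.1)).right j.2) • g j.1) (toConv q * toConv f).ofConv := by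
  intro x
  have e (b : H) : (toConv q * toConv f).ofConv b = sweedler k (fun c d => q c * f d) b :=
    convMul_apply_eq_sweedler _ _ _
  simp only [e, sweedler_smul]
  rw [← sweedler_coassoc (fun a c d => (q c * f d) • a)
    (by fun_prop) (by fun_prop) (by fun_prop), Finset.sum_sigma]
  let Q : H ⊗[k] H →ₗ[k] H := TensorProduct.lift (bilin (fun a b => q b • a)
    (by fun_prop) (by fun_prop))
  have := congrArg (Q ∘ₗ CoalgebraStruct.comul) (hf x)
  rw [map_sweedler _ (isLinearMap_coe _), map_sum] at this
  simp only [map_smul, LinearMap.comp_apply, ← sweedler_tmul,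
    map_sweedler _ (isLinearMap_coe Q)] at this
  simp only [Q, bilin, lift.tmul, LinearMap.mk₂_apply, smul_sweedler, smul_smul] at this
  refine (sweedler_congr (fun p z => sweedler_congr (fun a b => ?_) p) x).trans (this.trans ?_)
  · rw [mul_comm]
  · refine Finset.sum_congr rfl fun i _ => Finset.sum_congr rfl fun j _ => ?_
    rw [LinearMap.smul_apply, smul_eq_mul, mul_comm]

/-- The projection of a rational functional `f` to the coinvariants of the Hopf module of rational
functionals, `x ↦ ∑ f₀(x S²(f₁))`, is a left integral. -/
theorem IsCoaction.isLeftIntegral (hf : IsCoaction s h g f) :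
    IsLeftIntegral (IsLinearMap.mk' (fun x => ∑ i ∈ s, g i (x * antipode k (antipode k (h i))))
      (by fun_prop) : H →ₗ[k] k) := by
  rw [isLeftIntegral_iff]
  intro x
  -- `T(z) = ∑ gᵢ(x₂ S(z)) x₁ ⊗ hᵢ` and `T'(z) = ∑ gᵢ(x S(z₁)) (hᵢ)₁ z₂ ⊗ (hᵢ)₂` agree for all `z`
  let T : (H →ₗ[k] H) ⊗[k] H := ∑ i ∈ s, IsLinearMap.mk' (fun z =>
    sweedler k (fun a b => g i (b * antipode k z) • a) x) (by fun_prop) ⊗ₜ[k] h i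
  let T' : (H →ₗ[k] H) ⊗[k] H := ∑ i ∈ s, sweedler k (fun c d => (IsLinearMap.mk' (fun z =>
    sweedler k (fun v w => g i (x * antipode k v) • (c * w)) z) (by fun_prop)) ⊗ₜ[k] d) (h i)
  have hT : T = T' := by
    refine eq_of_rTensor_applyₗ_eq fun z => ?_
    have e1 : (LinearMap.applyₗ z).rTensor H T = ∑ i ∈ s, sweedler k (fun a b =>
        g i (b * antipode k z) • (a ⊗ₜ[k] h i)) x := by
      simp only [T, map_sum, LinearMap.rTensor_tmul, LinearMap.applyₗ_apply_apply,
        IsLinearMap.mk'_apply]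
      refine Finset.sum_congr rfl fun i _ => ?_
      rw [map_sweedler (k := k) (fun y => y ⊗ₜ[k] h i) (by fun_prop)]
      simp only [smul_tmul']
    have e2 : (LinearMap.applyₗ z).rTensor H T' = sweedler k (fun v w => ∑ i ∈ s,
        sweedler k (fun c d => g i (x * antipode k v) • ((c * w) ⊗ₜ[k] d)) (h i)) z := by
      rw [sweedler_sum]
      simp only [T', map_sum, map_sweedler_apply, LinearMap.rTensor_tmul,
        LinearMap.applyₗ_apply_apply, IsLinearMap.mk'_apply]
      refine Finset.sum_congr rfl fun i _ => ?_
      rw [sweedler_swap]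
      refine sweedler_congr (fun c d => ?_) (h i)
      rw [map_sweedler (k := k) (fun y => y ⊗ₜ[k] d) (by fun_prop)]
      simp only [smul_tmul']
    rw [e1, e2, ← sweedler_sum]
    refine (sweedler_apply_mul_antipode (fun a b => ∑ i ∈ s, g i b • (a ⊗ₜ[k] h i))
      (by fun_prop) (by fun_prop) x z).trans (sweedler_congr (fun v w => ?_) z)
    have := congrArg (LinearMap.rTensor H (LinearMap.mulRight k w))
      (hf.comul (x * antipode k v))
    simp only [map_sum, map_smul, ← sweedler_tmul, map_sweedler_apply, LinearMap.rTensor_tmul,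
      LinearMap.mulRight_apply, smul_sweedler] at this
    rw [sweedler_sum, this]
  -- the evaluation `φ ⊗ y ↦ φ(S(y))`
  let C : (H →ₗ[k] H) ⊗[k] H →ₗ[k] H := TensorProduct.lift
    (bilin (fun φ y => φ (antipode k y)) (by fun_prop) (by fun_prop))
  have key := congrArg C hT
  simp only [T, T', map_sum, map_sweedler_apply] at key
  simp only [C, bilin, lift.tmul, LinearMap.mk₂_apply, IsLinearMap.mk'_apply] at key
  simp only [IsLinearMap.mk'_apply, Finset.sum_smul]
  rw [sweedler_sum, key]
  refine Finset.sum_congr rfl fun i _ => ?_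
  have e (c d : H) : sweedler k (fun v w => g i (x * antipode k v) • (c * w)) (antipode k d) =
      sweedler k (fun v w => g i (x * antipode k (antipode k w)) • (c * antipode k v)) d :=
    sweedler_of_antipode _ (by fun_prop) (by fun_prop) d
  simp only [e]
  rw [← sweedler_coassoc (fun c v w => g i (x * antipode k (antipode k w)) • (c * antipode k v))
    (by fun_prop) (by fun_prop) (by fun_prop)]
  have e' (p w : H) := sweedler_mul_antipode (k := k)
    (fun z => g i (x * antipode k (antipode k w)) • z) (by fun_prop) p
  simp only [e']
  exact sweedler_counit_left (k := k)
    (fun w => g i (x * antipode k (antipode k w)) • (1 : H)) (by fun_prop) (h i)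

/-- A functional `f` is recovered from the coinvariants `E(f₀)` as `f = ∑ E(f₀) · f₁`, so a nonzero
rational functional gives a nonzero left integral. -/
theorem IsCoFrobenius.exists_isLeftIntegral (hH : IsCoFrobenius k H) :
    ∃ lam : H →ₗ[k] k, IsLeftIntegral lam ∧ lam ≠ 0 := by
  obtain ⟨f, hr, hf0⟩ := hH
  obtain ⟨n, h, g, hf⟩ := hr.exists_isCoaction
  by_contra! hno
  refine hf0 (LinearMap.ext fun x => ?_)
  -- the integrals built from `q * f`, for all `q`, vanish
  have hz (x : H) : ∑ i, sweedler k (fun a b =>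
      g i (x * antipode k (antipode k a)) • b) (h i) = 0 := by
    refine eq_of_forall_dual (k := k) fun q => ?_
    have := LinearMap.congr_fun (hno _ (hf.convMul q).isLeftIntegral) x
    simp only [IsLinearMap.mk'_apply, Finset.sum_sigma, LinearMap.smul_apply, smul_eq_mul,
      LinearMap.zero_apply] at this
    rw [map_zero, map_sum, ← this]
    refine Finset.sum_congr rfl fun i _ => ?_
    simp only [map_sweedler_apply, map_smul, smul_eq_mul, mul_comm]
    rfl
  let T : (H →ₗ[k] k) ⊗[k] H := ∑ i, sweedler k (fun a b => IsLinearMap.mk' (fun x =>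
    g i (x * antipode k (antipode k a))) (by fun_prop) ⊗ₜ[k] b) (h i)
  have hT : T = 0 := by
    refine eq_of_rTensor_applyₗ_eq fun x => (TensorProduct.lid k H).injective ?_
    have := hz x
    rw [map_zero, map_zero, ← LinearEquiv.coe_coe]
    simp only [T, map_sum, map_sweedler_apply, LinearMap.rTensor_tmul,
      LinearMap.applyₗ_apply_apply, IsLinearMap.mk'_apply]
    simpa only [LinearEquiv.coe_coe, TensorProduct.lid_tmul] using this
  -- the evaluation `φ ⊗ y ↦ φ(x S(y))`
  let C : (H →ₗ[k] k) ⊗[k] H →ₗ[k] k := TensorProduct.lift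
    (bilin (fun φ y => φ (x * antipode k y)) (by fun_prop) (by fun_prop))
  have key := congrArg C hT
  simp only [T, map_sum, map_sweedler_apply, map_zero] at key
  simp only [C, bilin, lift.tmul, LinearMap.mk₂_apply, IsLinearMap.mk'_apply, mul_assoc,
    ← antipode_mul_antidistrib] at key
  rw [LinearMap.zero_apply, ← key, ← hf.sum_counit x]
  refine Finset.sum_congr rfl fun i _ => ?_
  have := sweedler_antipode_mul (k := k) (fun z => g i (x * antipode k z)) (by fun_prop) (h i)
  rw [this, antipode_one, mul_one, smul_eq_mul, mul_comm]

end Integral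

/-! ### Nondegeneracy and invariance of integrals -/

section Nondegenerate

variable {k H : Type*} [Field k] [Ring H] [HopfAlgebra k H] {lam : H →ₗ[k] k}

namespace IsLeftIntegral

/-- `∑ lam(x₂) g(x₁) = lam(x) g(1)`. -/
theorem sweedler_smul_eq {V : Type*} [AddCommMonoid V] [Module k V] (hl : IsLeftIntegral lam)
    (g : H → V) (hg : IsLinearMap k g) (x : H) :
    sweedler k (fun a b => lam b • g a) x = lam x • g 1 := by
  have := congrArg g (isLeftIntegral_iff.1 hl x)
  rw [map_sweedler g hg, hg.map_smul] at this
  simpa only [hg.map_smul] using this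

/-- `∑ lam(m S(h₁)) h₂ = ∑ lam(m₂ S(h)) m₁`. -/
theorem sweedler_smul_mul_antipode (hl : IsLeftIntegral lam) (m h : H) :
    sweedler k (fun a b => lam (b * antipode k h) • a) m =
      sweedler k (fun s t => lam (m * antipode k s) • t) h := by
  refine (sweedler_apply_mul_antipode (fun a b => lam b • a) (by fun_prop) (by fun_prop)
    m h).trans (sweedler_congr (fun s t => ?_) h)
  rw [hl.sweedler_smul_eq (fun a => a * t) (by fun_prop), one_mul]

/-- `∑ lam(m l₂) l₁ = ∑ lam(m₂ l) S(m₁)`. -/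
theorem sweedler_smul_mul_left (hl : IsLeftIntegral lam) (m l : H) :
    sweedler k (fun a b => lam (m * b) • a) l =
      sweedler k (fun c d => lam (d * l) • antipode k c) m := by
  refine (sweedler_apply_mul_left (fun a b => lam b • a) (by fun_prop) (by fun_prop)
    m l).trans (sweedler_congr (fun c d => ?_) m)
  rw [hl.sweedler_smul_eq (fun a => antipode k c * a) (by fun_prop), mul_one]

/-- `h ↦ lam(- S(h))` is injective: if `lam(- S(h)) = 0` then `∑ lam(- S(h₁)) ⊗ h₂ = 0`, and
`∑ lam(m S²(h₂) S(h₁)) h₃ = lam(m) h`. -/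
theorem eq_zero_of_mul_antipode (hl : IsLeftIntegral lam) (h0 : lam ≠ 0) {h : H}
    (hh : ∀ m, lam (m * antipode k h) = 0) : h = 0 := by
  let T : (H →ₗ[k] k) ⊗[k] H := sweedler k (fun a b => IsLinearMap.mk' (fun x =>
    lam (x * antipode k a)) (by fun_prop) ⊗ₜ[k] b) h
  -- the kernel of `h ↦ lam(- S(h))` is a right coideal
  have hT : T = 0 := by
    refine eq_of_rTensor_applyₗ_eq fun x => (TensorProduct.lid k H).injective ?_
    rw [map_zero, map_zero, ← LinearEquiv.coe_coe]
    simp only [T, map_sweedler_apply, LinearMap.rTensor_tmul,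
      LinearMap.applyₗ_apply_apply, IsLinearMap.mk'_apply]
    simp only [LinearEquiv.coe_coe, TensorProduct.lid_tmul]
    rw [← hl.sweedler_smul_mul_antipode]
    simp [hh, sweedler]
  obtain ⟨m, hm⟩ : ∃ m, lam m ≠ 0 := by
    by_contra! hc
    exact h0 (LinearMap.ext hc)
  -- the evaluation `φ ⊗ y ↦ ∑ φ(m S²(y₁)) y₂`
  let C : (H →ₗ[k] k) ⊗[k] H →ₗ[k] H := TensorProduct.lift
    (bilin (fun φ y => sweedler k (fun c d => φ (m * antipode k (antipode k c)) • d) y)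
      (by fun_prop) (by fun_prop))
  have key := congrArg C hT
  simp only [T, map_sweedler_apply, map_zero] at key
  simp only [C, bilin, lift.tmul, LinearMap.mk₂_apply, IsLinearMap.mk'_apply, mul_assoc,
    ← antipode_mul_antidistrib] at key
  rw [← sweedler_coassoc (fun a c d => lam (m * antipode k (a * antipode k c)) • d)
    (by fun_prop) (by fun_prop) (by fun_prop)] at key
  have e (p d : H) := sweedler_mul_antipode (k := k)
    (fun z => lam (m * antipode k z) • d) (by fun_prop) p
  simp only [e, antipode_one, mul_one] at key
  rw [sweedler_counit_left (k := k) (fun d => lam m • d) (by fun_prop)] at key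
  exact (smul_eq_zero.1 key).resolve_left hm

variable {chi : H ≃ₐ[k] H}

/-- The antipode is surjective: by `lam(x m) = lam(χ(m) x)`, the elements `∑ lam(m₂ y) m₁`, which
span `H`, equal `∑ lam(χ(y) m₂) m₁` and so are in the image of `S`. -/
theorem antipode_surjective (hl : IsLeftIntegral lam) (h0 : lam ≠ 0) (hchi : IsFrobeniusAut chi) :
    Function.Surjective (antipode k : H →ₗ[k] H) := by
  have hr (m y : H) : sweedler k (fun a b => lam (b * y) • a) m ∈
      LinearMap.range (antipode k : H →ₗ[k] H) := by
    rw [sweedler_congr (fun a b => congrArg (· • a) (hchi lam hl y b)),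
      hl.sweedler_smul_mul_left]
    exact Submodule.sum_mem _ fun i _ => Submodule.smul_mem _ _ ⟨_, rfl⟩
  obtain ⟨y, hy⟩ : ∃ y, lam y ≠ 0 := by
    by_contra! hc
    exact h0 (LinearMap.ext hc)
  intro h
  have hm : sweedler k (fun p c => sweedler k (fun a b => lam (b * (antipode k c * y)) • a) p) h ∈
      LinearMap.range (antipode k : H →ₗ[k] H) := Submodule.sum_mem _ fun i _ => hr _ _
  simp only [← mul_assoc] at hm
  rw [sweedler_coassoc (fun a b c => lam (b * antipode k c * y) • a)
    (by fun_prop) (by fun_prop) (by fun_prop)] at hm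
  have e (a r : H) := sweedler_mul_antipode (k := k)
    (fun z => lam (z * y) • a) (by fun_prop) r
  simp only [e, one_mul] at hm
  rw [sweedler_counit_right (k := k) (fun a => lam y • a) (by fun_prop)] at hm
  exact (Submodule.smul_mem_iff _ hy).1 hm

/-- The bilinear form `lam(x m)` of a nonzero left integral is nondegenerate. -/
theorem eq_of_mul_right (hl : IsLeftIntegral lam) (h0 : lam ≠ 0) (hchi : IsFrobeniusAut chi)
    {x y : H} (hxy : ∀ m, lam (x * m) = lam (y * m)) : x = y := by
  obtain ⟨z, hz⟩ := hl.antipode_surjective h0 hchi (x - y)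
  have : z = 0 := hl.eq_zero_of_mul_antipode h0 fun m => by
    obtain ⟨m, rfl⟩ := chi.surjective m
    rw [hz, ← hchi lam hl, sub_mul, map_sub, hxy, sub_self]
  rw [← sub_eq_zero, ← hz, this, map_zero]

end IsLeftIntegral

theorem IsModularElement.sweedler_smul_eq {a : GroupLike k H} (ha : IsModularElement a)
    {V : Type*} [AddCommMonoid V] [Module k V] (hl : IsLeftIntegral lam)
    (g : H → V) (hg : IsLinearMap k g) (x : H) :
    sweedler k (fun y z => lam y • g z) x = lam x • g (a⁻¹).val := by
  have := ha lam hl x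
  rw [← sweedler_tmul, map_sweedler_apply, ← LinearEquiv.coe_coe, map_sweedler_apply] at this
  simp only [LinearMap.rTensor_tmul, LinearEquiv.coe_coe, TensorProduct.lid_tmul] at this
  have := congrArg g this
  rw [map_sweedler g hg, hg.map_smul] at this
  simpa only [hg.map_smul] using this

/-- `∑ lam(l₁ h) l₂ = ∑ lam(l h₁) a⁻¹ S(h₂)`. -/
theorem IsModularElement.sweedler_smul_mul_right {a : GroupLike k H} (ha : IsModularElement a)
    (hl : IsLeftIntegral lam) (l h : H) :
    sweedler k (fun x y => lam (x * h) • y) l =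
      sweedler k (fun c d => lam (l * c) • ((a⁻¹).val * antipode k d)) h :=
  (sweedler_apply_mul_right (fun x y => lam x • y) (by fun_prop) (by fun_prop)
    l h).trans (sweedler_congr (fun c d =>
      ha.sweedler_smul_eq hl (fun y => y * antipode k d) (by fun_prop) (l * c)) h)

/-- `∑ lam(S(l) h₁) h₂ = ∑ lam(S(l₂) h) l₁ a⁻¹`. -/
theorem IsModularElement.sweedler_smul_antipode_mul {a : GroupLike k H} (ha : IsModularElement a)
    (hl : IsLeftIntegral lam) (l h : H) :
    sweedler k (fun x y => lam (antipode k l * x) • y) h =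
      sweedler k (fun c d => lam (antipode k d * h) • (c * (a⁻¹).val)) l :=
  (sweedler_apply_antipode_mul (fun x y => lam x • y) (by fun_prop) (by fun_prop)
    l h).trans (sweedler_congr (fun c d =>
      ha.sweedler_smul_eq hl (fun y => c * y) (by fun_prop) (antipode k d * h)) l)

end Nondegenerate

/-! ### Comparison of `u` and `v` -/

section Comparison

variable {k H : Type*} [Field k] [Ring H] [HopfAlgebra k H] {lam : H →ₗ[k] k}
  {σ : H →ₗ[k] H →ₗ[k] k} {a : GroupLike k H} {chi : H ≃ₐ[k] H}

/-- `∑ lam(l₁ h₁) σ(h₂, l₂) = ∑ σ(h₁, l₁) lam(h₂ l₂)`. -/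
theorem IsCoquasitriangular.comm_apply (hσ : IsCoquasitriangular σ) (lam : H →ₗ[k] k) (h l : H) :
    sweedler k (fun x y => sweedler k (fun z w => lam (z * x) * σ y w) l) h =
      sweedler k (fun x y => sweedler k (fun z w => lam (y * w) * σ x z) l) h := by
  have := congrArg lam (hσ.comm_sweedler h l)
  simp only [map_sweedler_apply, map_smul, smul_eq_mul] at this
  simpa only [mul_comm (σ _ _)] using this

/-- `∑ v(h₁) h₂ = ∑ χ(h₁) (u * α_a)(h₂)`. -/
theorem sweedler_drinfeldV_smul (hσ : IsCoquasitriangular σ) (ha : IsModularElement a)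
    (hl : IsLeftIntegral lam) (h0 : lam ≠ 0) (hchi : IsFrobeniusAut chi) (h : H) :
    sweedler k (fun x y => drinfeldV σ x • y) h =
      sweedler k (fun x y =>
        (toConv (drinfeldU σ) * toConv (alphaOf σ a)).ofConv y • chi x) h := by
  refine hl.eq_of_mul_right h0 hchi fun l => ?_
  have key := hσ.comm_apply lam h l
  -- `∑ σ(h₁, l₁) lam(h₂ l₂) = ∑ v(h₁) lam(h₂ l)`
  have e1 (x y : H) : sweedler k (fun z w => lam (y * w) * σ x z) l =
      sweedler k (fun c d => lam (d * l) * σ x (antipode k c)) y := by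
    simpa only [map_sweedler_apply, map_smul, smul_eq_mul] using
      congrArg (σ x) (hl.sweedler_smul_mul_left y l)
  -- `∑ lam(l₁ h₁) σ(h₂, l₂) = ∑ lam(l h₁) (u * α_a)(h₂)`
  have e2 (x y : H) : sweedler k (fun z w => lam (z * x) * σ y w) l =
      sweedler k (fun c d => lam (l * c) * σ y ((a⁻¹).val * antipode k d)) x := by
    simpa only [map_sweedler_apply, map_smul, smul_eq_mul] using
      congrArg (σ y) (ha.sweedler_smul_mul_right hl l x)
  have e3 (r : H) : sweedler k (fun d y => σ y ((a⁻¹).val * antipode k d)) r =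
      (toConv (drinfeldU σ) * toConv (alphaOf σ a)).ofConv r := by
    rw [ofConv_convMul_apply]
    simp only [hσ.mul_right_sweedler, drinfeldU_apply, sweedler_mul, alphaOf,
      LinearMap.flip_apply]
    exact (sweedler_coassoc (fun d s t => σ s (antipode k d) * σ t (a⁻¹).val)
      (by fun_prop) (by fun_prop) (by fun_prop) r).symm
  simp only [e1, e2] at key
  rw [sweedler_coassoc (fun c d y => lam (l * c) * σ y ((a⁻¹).val * antipode k d))
    (by fun_prop) (by fun_prop) (by fun_prop),
    ← sweedler_coassoc (fun x c d => lam (d * l) * σ x (antipode k c))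
    (by fun_prop) (by fun_prop) (by fun_prop)] at key
  simp only [← mul_sweedler, e3, hchi lam hl _ l] at key
  simp only [mul_comm (lam _), ← hσ.drinfeldV_apply] at key
  simp only [sweedler_mul, map_sweedler_apply, smul_mul_assoc, map_smul, smul_eq_mul]
  exact key.symm

/-- `∑ χ(S(l₁)) v(l₂) = ∑ (β_a * u)(l₁) S(l₂)`. -/
theorem sweedler_drinfeldV_smul_antipode (hσ : IsCoquasitriangular σ) (ha : IsModularElement a)
    (hl : IsLeftIntegral lam) (h0 : lam ≠ 0) (hchi : IsFrobeniusAut chi) (l : H) :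
    sweedler k (fun x y => drinfeldV σ y • chi (antipode k x)) l =
      sweedler k (fun x y =>
        (toConv (betaOf σ a) * toConv (drinfeldU σ)).ofConv x • antipode k y) l := by
  refine hl.eq_of_mul_right h0 hchi fun h => ?_
  have key := hσ.comm_apply lam h (antipode k l)
  rw [sweedler_swap, sweedler_swap (k := k) _ h,
    sweedler_of_antipode _ (by fun_prop) (by fun_prop),
    sweedler_of_antipode _ (by fun_prop) (by fun_prop)] at key
  -- `∑ σ(h₁, S(l₂)) lam(h₂ S(l₁)) = ∑ lam(h S(l₁)) v(l₂)`
  have e1 (z w : H) : sweedler k (fun x y => lam (y * antipode k z) * σ x (antipode k w)) h =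
      sweedler k (fun s t => lam (h * antipode k s) * σ t (antipode k w)) z := by
    have := congrArg (σ.flip (antipode k w)) (hl.sweedler_smul_mul_antipode h z)
    simp only [map_sweedler_apply, map_smul, smul_eq_mul] at this
    exact this
  -- `∑ lam(S(l₂) h₁) σ(h₂, S(l₁)) = ∑ (β_a * u)(l₁) lam(S(l₂) h)`
  have e2 (z w : H) : sweedler k (fun x y => lam (antipode k w * x) * σ y (antipode k z)) h =
      sweedler k (fun c d => lam (antipode k d * h) * σ (c * (a⁻¹).val) (antipode k z)) w := by
    have := congrArg (σ.flip (antipode k z)) (ha.sweedler_smul_antipode_mul hl w h)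
    simp only [map_sweedler_apply, map_smul, smul_eq_mul] at this
    exact this
  have e3 (r : H) : sweedler k (fun z c => σ (c * (a⁻¹).val) (antipode k z)) r =
      (toConv (betaOf σ a) * toConv (drinfeldU σ)).ofConv r := by
    have e4 (z c : H) : σ (c * (a⁻¹).val) (antipode k z) =
        sweedler k (fun s t => σ a.val s * σ c (antipode k t)) z := by
      rw [hσ.mul_left_sweedler, sweedler_of_antipode _ (by fun_prop) (by fun_prop)]
      exact sweedler_congr (fun s t => by
        rw [GroupLike.val_inv, hσ.antipode_antipode, mul_comm]) z
    rw [ofConv_convMul_apply]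
    simp only [e4, drinfeldU_apply, mul_sweedler, betaOf]
    exact sweedler_coassoc (fun s t c => σ a.val s * σ c (antipode k t))
      (by fun_prop) (by fun_prop) (by fun_prop) r
  simp only [e1, e2] at key
  rw [← sweedler_coassoc (fun z c d => lam (antipode k d * h) * σ (c * (a⁻¹).val) (antipode k z))
    (by fun_prop) (by fun_prop) (by fun_prop),
    sweedler_coassoc (fun s t w => lam (h * antipode k s) * σ t (antipode k w))
    (by fun_prop) (by fun_prop) (by fun_prop)] at key
  simp only [← mul_sweedler, e3, ← hσ.drinfeldV_apply, hchi lam hl _ h] at key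
  simp only [sweedler_mul, map_sweedler_apply, smul_mul_assoc, map_smul, smul_eq_mul]
  simpa only [mul_comm (lam _)] using key.symm

/-- The character `α_a` of `H`. -/
def alphaHom (hσ : IsCoquasitriangular σ) (a : GroupLike k H) : H →ₐ[k] k :=
  AlgHom.ofLinearMap (alphaOf σ a)
    (by rw [alphaOf, LinearMap.flip_apply, hσ.left_one, (a⁻¹).isGroupLikeElem_val.counit_eq_one])
    (fun x y => by
      simp only [alphaOf, LinearMap.flip_apply, hσ.mul_left_sweedler]
      exact sweedler_of_groupLike (fun z w => σ x z * σ y w) (by fun_prop) (by fun_prop)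
        (a⁻¹).isGroupLikeElem_val)

end Comparison

end CoFrobeniusHopf

end

theorem mainTheorem2 {k H : Type*} [Field k] [Ring H] [HopfAlgebra k H]
    (hH : CoFrobeniusHopf.IsCoFrobenius k H)
    (σ : H →ₗ[k] H →ₗ[k] k) (hσ : CoFrobeniusHopf.IsCoquasitriangular σ)
    (a : GroupLike k H) (ha : CoFrobeniusHopf.IsModularElement a)
    (α : H →ₗ[k] k) (hα : CoFrobeniusHopf.IsModularFunctional α) :
    ∃ u : (WithConv (H →ₗ[k] k))ˣ,
      (u : WithConv (H →ₗ[k] k)) = toConv (CoFrobeniusHopf.drinfeldU σ) ∧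
      (↑u⁻¹ : WithConv (H →ₗ[k] k)) * toConv (CoFrobeniusHopf.drinfeldV σ) =
        toConv (CoFrobeniusHopf.drinfeldV σ) * (↑u⁻¹ : WithConv (H →ₗ[k] k)) ∧
      toConv (CoFrobeniusHopf.drinfeldV σ) * (↑u⁻¹ : WithConv (H →ₗ[k] k)) =
        toConv α * toConv (CoFrobeniusHopf.betaOf σ a) ∧
      toConv α * toConv (CoFrobeniusHopf.betaOf σ a) =
        toConv α * toConv (CoFrobeniusHopf.alphaOf σ a) := by
  open CoFrobeniusHopf in
  obtain ⟨lam, hl, h0⟩ := hH.exists_isLeftIntegral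
  obtain ⟨chi, hchi, hα'⟩ := hα
  obtain ⟨u, hu⟩ := hσ.exists_unit_drinfeldU
  let γ : H →ₐ[k] k := (Bialgebra.counitAlgHom k H).comp chi.toAlgHom
  obtain rfl : α = γ.toLinearMap := LinearMap.ext hα'
  -- `v = α * u * α_a`
  have h1 : toConv (drinfeldV σ) =
      toConv γ.toLinearMap * (toConv (drinfeldU σ) * toConv (alphaOf σ a)) := by
    ext h
    have := congrArg (counit : H →ₗ[k] k) (sweedler_drinfeldV_smul hσ ha hl h0 hchi h)
    simp only [map_sweedler_apply, map_smul, smul_eq_mul] at this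
    have e := sweedler_counit_right (k := k) (fun x => drinfeldV σ x) (by fun_prop) h
    simp only [smul_eq_mul, mul_comm (counit _)] at e
    simp only [mul_comm _ (counit (chi _))] at this
    exact (e.symm.trans this).trans (ofConv_convMul_apply γ.toLinearMap
      (toConv (drinfeldU σ) * toConv (alphaOf σ a)).ofConv h).symm
  -- `α⁻¹ * v = β_a * u`
  have h2 : toConv (γ.toLinearMap ∘ₗ antipode k) * toConv (drinfeldV σ) =
      toConv (betaOf σ a) * toConv (drinfeldU σ) := by
    ext h
    have := congrArg (counit : H →ₗ[k] k) (sweedler_drinfeldV_smul_antipode hσ ha hl h0 hchi h)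
    simp only [map_sweedler_apply, map_smul, smul_eq_mul, counit_antipode] at this
    have e := sweedler_counit_right (k := k) (fun x =>
      (toConv (betaOf σ a) * toConv (drinfeldU σ)).ofConv x) (by fun_prop) h
    simp only [smul_eq_mul, mul_comm (counit _)] at e
    refine Eq.trans ?_ (this.trans e)
    refine (convMul_apply_eq_sweedler _ _ h).trans (sweedler_congr (fun x y => mul_comm _ _) h)
  have h2' : toConv (drinfeldV σ) =
      toConv γ.toLinearMap * (toConv (betaOf σ a) * toConv (drinfeldU σ)) := by
    rw [← h2, ← mul_assoc, convMul_comp_antipode, one_mul]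
  have c1 := hσ.commute_algHom_drinfeldU γ
  have c2 : toConv (alphaOf σ a) * toConv (drinfeldU σ) =
      toConv (drinfeldU σ) * toConv (alphaOf σ a) :=
    hσ.commute_algHom_drinfeldU (alphaHom hσ a)
  rw [← hu] at h1 h2' c1 c2
  have h3 : toConv (drinfeldV σ) * (↑u⁻¹ : WithConv (H →ₗ[k] k)) =
      toConv γ.toLinearMap * toConv (alphaOf σ a) := by
    rw [h1, ← c2, ← mul_assoc, Units.mul_inv_cancel_right]
  have h4 : toConv (drinfeldV σ) * (↑u⁻¹ : WithConv (H →ₗ[k] k)) =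
      toConv γ.toLinearMap * toConv (betaOf σ a) := by
    rw [h2', ← mul_assoc, Units.mul_inv_cancel_right]
  refine ⟨u, hu, ?_, h4, h4.symm.trans h3⟩
  rw [h3, h1, ← mul_assoc (toConv γ.toLinearMap), c1, mul_assoc, Units.inv_mul_cancel_left]
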